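/- There is an absolute constant $c>0$ such that the following holds for all integers $M\ge 1$, $N>M$ and $T\ge 1$. Model. There are $M$ clients and $N$ channels. A configuration $\nu$ prescribes means $\mu_k(t)\in[0,1]$ for $1\le k\le N$, $1\le t\le T$; given $\nu$, the states $X_k(t)\in\{0,1\}$ (Bad/Good) are independent Bernoulli variables with means $\mu_k(t)$. In each round $t$ a policy assigns distinct channels to the $M$ clients, possibly at random, based only on its earlier assignments and the observed states of the channels it used (combinatorial semi-bandit feedback). The age of information (AoI) of client $i$ starts at $a_i(0)=1$; $a_i(t)=1$ if the channel assigned to client $i$ in round $t$ is Good, and $a_i(t)=a_i(t-1)+1$ otherwise. A super-arm is a set of $M$ channels; it is best in round $t$ if its sum of means $\mu_k(t)$ is maximal. A breakpoint is a round in which the vector of means differs from that of the preceding round. An oracle knows the configuration. It is either (a) a strategy which in every round uses a best super-arm, assigned to the clients depending on the configuration and on channel states of earlier rounds only, or (b) a strategy which moreover sees the channel states of the current round and minimizes the expected cumulative AoI $\mathbb E\sum_{i,t}a_i(t)$, under every configuration, among all strategies with this information. For a probability distribution $D$ of the configuration, the AoI regret of a policy $\pi$ relative to an oracle is $$R_\pi(T)=\sum_{i=1}^M\sum_{t=1}^T\mathbb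 E\big[a_i^{\pi}(t)-a_i^{*}(t)\big],$$ where $a_i^\pi$ and $a_i^*$ are the ages under $\pi$ and under the oracle, and the expectation is over the configuration drawn from $D$, the channel states, and the randomization of the policy. Claim. There is a discrete probability distribution $D$ on configurations, each configuration in its support having at most one breakpoint and, if $T\ge 2$, a round in which the best super-arm changes (no super-arm is best both in that round and in the preceding one), such that every policy $\pi$ and every oracle of type (a) or (b) satisfy $$R_\pi(T)\ \ge\ c\,\sqrt{\frac{MT}{N}} .$$ -/

import Mathlib

open Finset
open scoped BigOperators

noncomputable section

namespace ChannelAoI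

/-- A channel configuration over `T` rounds: `ν t k` is the mean of the Bernoulli state
(Good = `true`, Bad = `false`) of channel `k` in round `t`. The element `t` of `Fin T` stands for
round `t + 1`. -/
abbrev Config (N T : ℕ) : Type := Fin T → Fin N → unitInterval

/-- A realization of the states of all channels in all rounds. -/
abbrev States (N T : ℕ) : Type := Fin T → Fin N → Bool

/-- A schedule for one round: distinct channels for the `M` clients. -/
abbrev Assignment (M N : ℕ) : Type := Fin M ↪ Fin N

/-- Rounds in which some channel mean differs from its value in the preceding round. -/
def breakpoints {N T : ℕ} (ν : Config N T) : Set (Fin T) :=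
  {t | ∃ s : Fin T, (s : ℕ) + 1 = t ∧ ν s ≠ ν t}

/-- `A` is a best super-arm for round `t`: a set of `M` channels with maximal sum of means. -/
def IsBestSuperArm {N T : ℕ} (M : ℕ) (ν : Config N T) (t : Fin T) (A : Finset (Fin N)) : Prop :=
  A.card = M ∧ ∀ B : Finset (Fin N), B.card = M →
    ∑ k ∈ B, (ν t k : ℝ) ≤ ∑ k ∈ A, (ν t k : ℝ)

/-- The best super-arm changes in some round: no super-arm is best both there and in the
preceding round. -/
def BestSuperArmChanges {N T : ℕ} (M : ℕ) (ν : Config N T) : Prop :=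
  ∃ s t : Fin T, (s : ℕ) + 1 = t ∧
    ∀ A : Finset (Fin N), ¬ (IsBestSuperArm M ν s A ∧ IsBestSuperArm M ν t A)

/-- Age of information after `n` rounds of a client whose transmission in round `m + 1` succeeds
iff `g m = true`. -/
def aoi (g : ℕ → Bool) : ℕ → ℕ
  | 0 => 1
  | n + 1 => if g n then 1 else aoi g n + 1

/-- Success of client `i` when the states are `x` and the schedule is `a`. -/
def success {M N T : ℕ} (x : States N T) (a : Fin T → Assignment M N) (i : Fin M) (n : ℕ) : Bool :=
  if h : n < T then x ⟨n, h⟩ (a ⟨n, h⟩ i) else false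

/-- The sum over all clients and over the rounds `1, …, T` of the age of information. -/
def totalAoI {M N T : ℕ} (x : States N T) (a : Fin T → Assignment M N) : ℝ :=
  ∑ i : Fin M, ∑ t : Fin T, (aoi (success x a i) (t + 1) : ℝ)

/-- Probability of the states `x` under the configuration `ν`: all states are independent. -/
def stateProb {N T : ℕ} (ν : Config N T) (x : States N T) : ℝ :=
  ∏ t : Fin T, ∏ k : Fin N, if x t k then (ν t k : ℝ) else 1 - (ν t k : ℝ)

/-- What is known after `n` rounds under semi-bandit feedback: the schedules used so far and,
for each of them, the observed state of every channel that was used. -/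
abbrev History (M N n : ℕ) : Type := Fin n → Assignment M N × (Fin M → Bool)

/-- A (randomized) scheduling policy: after each history, a law for the next schedule. -/
abbrev Policy (M N : ℕ) : Type := (n : ℕ) → History M N n → PMF (Assignment M N)

/-- The history before round `t` when the states are `x` and the schedules are `a`. -/
def history {M N T : ℕ} (x : States N T) (a : Fin T → Assignment M N) (t : Fin T) :
    History M N t :=
  fun s => (a ⟨s, s.isLt.trans t.isLt⟩,
    fun i => x ⟨s, s.isLt.trans t.isLt⟩ (a ⟨s, s.isLt.trans t.isLt⟩ i))

/-- Conditional probability, given the states `x`, that `π` uses the schedules `a`. -/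
def actionProb {M N T : ℕ} (π : Policy M N) (x : States N T) (a : Fin T → Assignment M N) : ℝ :=
  ∏ t : Fin T, (π t (history x a t) (a t)).toReal

/-- Expected total age of information of the policy `π` under the configuration `ν`. -/
def policyAoI {M N T : ℕ} (ν : Config N T) (π : Policy M N) : ℝ :=
  ∑ x : States N T, stateProb ν x *
    ∑ a : Fin T → Assignment M N, actionProb π x a * totalAoI x a

/-- A strategy that knows the configuration and may use realized states; the predicates below
say which ones. -/
abbrev Informed (M N T : ℕ) : Type := Config N T → Fin T → States N T → Assignment M N

/-- The schedule of a round is determined by the configuration and the states of earlier rounds. -/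
def Informed.UsesPast {M N T : ℕ} (o : Informed M N T) : Prop :=
  ∀ ν t, ∀ x y : States N T, (∀ s, s < t → x s = y s) → o ν t x = o ν t y

/-- The schedule of a round is determined by the configuration and the states of that round and
of earlier rounds. -/
def Informed.UsesCSI {M N T : ℕ} (o : Informed M N T) : Prop :=
  ∀ ν t, ∀ x y : States N T, (∀ s, s ≤ t → x s = y s) → o ν t x = o ν t y

/-- Expected total age of information of an informed strategy under the configuration `ν`. -/
def informedAoI {M N T : ℕ} (ν : Config N T) (o : Informed M N T) : ℝ :=
  ∑ x : States N T, stateProb ν x * totalAoI x (fun t => o ν t x)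

/-- An oracle that knows the current channel means: in each round it schedules the clients on a
best super-arm. -/
def Informed.IsMeanOracle {M N T : ℕ} (o : Informed M N T) : Prop :=
  o.UsesPast ∧ ∀ ν t x, IsBestSuperArm M ν t (univ.map (o ν t x))

/-- An oracle that also sees the realized states of the current round, and minimizes the expected
total age of information among all such strategies. -/
def Informed.IsCSIOracle {M N T : ℕ} (o : Informed M N T) : Prop :=
  o.UsesCSI ∧ ∀ o' : Informed M N T, o'.UsesCSI → ∀ ν, informedAoI ν o ≤ informedAoI ν o'

/-- AoI regret of `π` relative to the oracle `o`, when the configuration is drawn from `D`. -/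
def regret {M N T : ℕ} (D : PMF (Config N T)) (π : Policy M N) (o : Informed M N T) : ℝ :=
  ∑' ν : Config N T, (D ν).toReal * (policyAoI ν π - informedAoI ν o)

end ChannelAoI

end

/-! Le Cam's two-point method on a uniform pair of configurations. From the second round on, the
good channels (mean `p = 1/2 + 1/(4√T)`) are the first `M` channels in one configuration and the
same with channel `M - 1` exchanged for channel `M` (indices from 0) in the other; all remaining
means are `q = 1 - p`. In the first round the two good sets are interchanged, which supplies the
single breakpoint when `T ≥ 2`.

Ages are at least 1, so each use of a bad channel costs at least `p - q` beyond the age of a client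
always served with probability `p` (`policyAoI_ge`). Both kinds of oracle do at least as well as
that benchmark (`informedAoI_hardConfig_le`). The good sets share only `M - 1` channels, so in every
round some client is on a channel that is bad in at least one configuration (`sum_badUses_add_ge`).
The laws of the full state matrices overlap in mass at least `1/4`
(`sum_min_stateProb_hardConfig_ge`), so no policy can tell them apart, even from unobserved states.
The regret is thus at least `√T / 16`, and `M < N` gives the claim. -/

namespace ChannelAoI

/-! ### The state law of one round -/

/-- Probability of the states `y` of all channels in a round with means `m`. -/
noncomputable def rowProb {N : ℕ} (m : Fin N → unitInterval) (y : Fin N → Bool) : ℝ :=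
  ∏ k : Fin N, if y k then (m k : ℝ) else 1 - (m k : ℝ)

theorem rowProb_nonneg {N : ℕ} (m : Fin N → unitInterval) (y : Fin N → Bool) :
    0 ≤ rowProb m y := by
  refine prod_nonneg fun k _ => ?_
  have h0 := (m k).2.1
  have h1 := (m k).2.2
  split_ifs <;> linarith

/-- Common source of the normalization, the one-channel marginal and the affinity of product
Bernoulli laws, by the choice of `f`. -/
theorem sum_prod_bool {N : ℕ} (f : Fin N → Bool → ℝ) :
    ∑ y : Fin N → Bool, ∏ k, f k (y k) = ∏ k, (f k true + f k false) := by
  have h := Finset.prod_univ_sum (fun _ : Fin N => (univ : Finset Bool)) f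
  simp only [Fintype.piFinset_univ, Fintype.sum_bool] at h
  exact h.symm

theorem sum_rowProb {N : ℕ} (m : Fin N → unitInterval) : ∑ y, rowProb m y = 1 := by
  have h := sum_prod_bool (fun k b => if b then (m k : ℝ) else 1 - (m k : ℝ))
  simpa [rowProb] using h

theorem sum_rowProb_mul {N : ℕ} (m : Fin N → unitInterval) (k : Fin N) (h : Bool → ℝ) :
    ∑ y, rowProb m y * h (y k) = (m k : ℝ) * h true + (1 - (m k : ℝ)) * h false := by
  have key := sum_prod_bool (fun l b => (if b then (m l : ℝ) else 1 - (m l : ℝ)) *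
    (if l = k then h b else 1))
  simp only [prod_mul_distrib, prod_ite_eq', mem_univ, if_true] at key
  rw [show (∑ y, rowProb m y * h (y k)) = _ from key]
  rw [prod_eq_single k]
  · simp
  · intro l _ hl
    simp [hl]
  · simp

theorem stateProb_eq {N T : ℕ} (ν : Config N T) (x : States N T) :
    stateProb ν x = ∏ t, rowProb (ν t) (x t) := rfl

theorem stateProb_nonneg {N T : ℕ} (ν : Config N T) (x : States N T) : 0 ≤ stateProb ν x :=
  prod_nonneg fun _ _ => rowProb_nonneg _ _

/-! ### Splitting off the last round -/

theorem sum_snoc {T : ℕ} {β : Type*} [Fintype β] (F : (Fin (T + 1) → β) → ℝ) :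
    ∑ x, F x = ∑ x : Fin T → β, ∑ y : β, F (Fin.snoc (α := fun _ => β) x y) := by
  rw [← (Fin.snocEquiv (fun _ : Fin (T + 1) => β)).sum_comp, Fintype.sum_prod_type, sum_comm]
  rfl

theorem stateProb_snoc {N T : ℕ} (ν : Config N (T + 1)) (x : States N T) (y : Fin N → Bool) :
    stateProb ν (Fin.snoc (α := fun _ => Fin N → Bool) x y) =
      stateProb (fun t => ν t.castSucc) x * rowProb (ν (Fin.last T)) y := by
  simp [stateProb_eq, Fin.prod_univ_castSucc]

/-- The history after all `T` rounds. -/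
def fullHistory {M N T : ℕ} (x : States N T) (a : Fin T → Assignment M N) : History M N T :=
  fun s => (a s, fun i => x s (a s i))

theorem history_snoc_castSucc {M N T : ℕ} (x : States N T) (a : Fin T → Assignment M N)
    (y : Fin N → Bool) (b : Assignment M N) (t : Fin T) :
    history (Fin.snoc (α := fun _ => Fin N → Bool) x y)
      (Fin.snoc (α := fun _ => Assignment M N) a b) t.castSucc = history x a t := by
  funext s
  have hs : (⟨s, s.isLt.trans t.castSucc.isLt⟩ : Fin (T + 1)) =
    Fin.castSucc ⟨s, s.isLt.trans t.isLt⟩ := rfl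
  simp only [history, hs, Fin.snoc_castSucc]

theorem history_snoc_last {M N T : ℕ} (x : States N T) (a : Fin T → Assignment M N)
    (y : Fin N → Bool) (b : Assignment M N) :
    history (Fin.snoc (α := fun _ => Fin N → Bool) x y)
      (Fin.snoc (α := fun _ => Assignment M N) a b) (Fin.last T) = fullHistory x a := by
  funext s
  have hs : (⟨s, s.isLt.trans (Fin.last T).isLt⟩ : Fin (T + 1)) = Fin.castSucc ⟨s, s.isLt⟩ := rfl
  simp only [history, hs, Fin.snoc_castSucc]
  rfl

/-- Causality: the factor for the last schedule does not involve the last row `y`. -/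
theorem actionProb_snoc {M N T : ℕ} (π : Policy M N) (x : States N T)
    (a : Fin T → Assignment M N) (y : Fin N → Bool) (b : Assignment M N) :
    actionProb π (Fin.snoc (α := fun _ => Fin N → Bool) x y)
      (Fin.snoc (α := fun _ => Assignment M N) a b) =
      actionProb π x a * (π T (fullHistory x a) b).toReal := by
  rw [actionProb, Fin.prod_univ_castSucc, history_snoc_last]
  simp only [history_snoc_castSucc, Fin.snoc_castSucc, Fin.snoc_last]
  rfl

theorem actionProb_nonneg {M N T : ℕ} (π : Policy M N) (x : States N T)
    (a : Fin T → Assignment M N) : 0 ≤ actionProb π x a :=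
  prod_nonneg fun _ _ => ENNReal.toReal_nonneg

theorem sum_toReal_eq_one {α : Type*} [Fintype α] (P : PMF α) : ∑ b, (P b).toReal = 1 := by
  rw [← ENNReal.toReal_sum fun b _ => P.apply_ne_top b, ← tsum_fintype (L := .unconditional _),
    P.tsum_coe, ENNReal.toReal_one]

theorem aoi_congr {g h : ℕ → Bool} : ∀ n, (∀ m < n, g m = h m) → aoi g n = aoi h n
  | 0, _ => rfl
  | n + 1, H => by
    simp only [aoi, H n n.lt_succ_self, aoi_congr n fun m hm => H m (hm.trans n.lt_succ_self)]

theorem one_le_aoi (g : ℕ → Bool) (n : ℕ) : 1 ≤ aoi g n := by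
  cases n with
  | zero => exact le_rfl
  | succ n => simp only [aoi]; split_ifs <;> omega

theorem success_snoc_lt {M N T : ℕ} (x : States N T) (a : Fin T → Assignment M N)
    (y : Fin N → Bool) (b : Assignment M N) (i : Fin M) {n : ℕ} (hn : n < T) :
    success (Fin.snoc (α := fun _ => Fin N → Bool) x y)
      (Fin.snoc (α := fun _ => Assignment M N) a b) i n = success x a i n := by
  have h : (⟨n, hn.trans T.lt_succ_self⟩ : Fin (T + 1)) = Fin.castSucc ⟨n, hn⟩ := rfl
  rw [success, success, dif_pos (hn.trans T.lt_succ_self), dif_pos hn, h, Fin.snoc_castSucc,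
    Fin.snoc_castSucc]

theorem success_snoc_last {M N T : ℕ} (x : States N T) (a : Fin T → Assignment M N)
    (y : Fin N → Bool) (b : Assignment M N) (i : Fin M) :
    success (Fin.snoc (α := fun _ => Fin N → Bool) x y)
      (Fin.snoc (α := fun _ => Assignment M N) a b) i T = y (b i) := by
  have h : (⟨T, T.lt_succ_self⟩ : Fin (T + 1)) = Fin.last T := rfl
  rw [success, dif_pos T.lt_succ_self, h, Fin.snoc_last, Fin.snoc_last]

/-- Age of client `i` after the last round. -/
def finalAge {M N T : ℕ} (i : Fin M) (x : States N T) (a : Fin T → Assignment M N) : ℝ :=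
  (aoi (success x a i) T : ℝ)

/-- Cumulative age of client `i`. -/
def clientAoI {M N T : ℕ} (i : Fin M) (x : States N T) (a : Fin T → Assignment M N) : ℝ :=
  ∑ t : Fin T, (aoi (success x a i) (t + 1) : ℝ)

theorem one_le_finalAge {M N T : ℕ} (i : Fin M) (x : States N T) (a : Fin T → Assignment M N) :
    1 ≤ finalAge i x a := by
  rw [finalAge]
  exact_mod_cast one_le_aoi _ _

theorem finalAge_snoc {M N T : ℕ} (i : Fin M) (x : States N T) (a : Fin T → Assignment M N)
    (y : Fin N → Bool) (b : Assignment M N) :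
    finalAge i (Fin.snoc (α := fun _ => Fin N → Bool) x y)
      (Fin.snoc (α := fun _ => Assignment M N) a b) =
      if y (b i) then 1 else finalAge i x a + 1 := by
  rw [finalAge, aoi, success_snoc_last, aoi_congr T fun m hm => success_snoc_lt x a y b i hm]
  split_ifs <;> simp [finalAge]

theorem clientAoI_snoc {M N T : ℕ} (i : Fin M) (x : States N T) (a : Fin T → Assignment M N)
    (y : Fin N → Bool) (b : Assignment M N) :
    clientAoI i (Fin.snoc (α := fun _ => Fin N → Bool) x y)
      (Fin.snoc (α := fun _ => Assignment M N) a b) =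
      clientAoI i x a + if y (b i) then 1 else finalAge i x a + 1 := by
  rw [← finalAge_snoc, clientAoI, Fin.sum_univ_castSucc]
  congr 1
  refine sum_congr rfl fun t _ => ?_
  rw [Fin.val_castSucc, aoi_congr _ fun m hm => success_snoc_lt x a y b i (by omega)]

theorem totalAoI_eq {M N T : ℕ} (x : States N T) (a : Fin T → Assignment M N) :
    totalAoI x a = ∑ i, clientAoI i x a := rfl

/-! ### Expected ages of policies and oracles -/

/-- Expected age after `n` rounds of a client which is served with probability `p` in each. -/
def meanAge (p : ℝ) : ℕ → ℝ
  | 0 => 1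
  | n + 1 => 1 + (1 - p) * meanAge p n

/-- Expectation of `F` over the states and the schedules used by `π`. -/
noncomputable def expect {M N T : ℕ} (ν : Config N T) (π : Policy M N)
    (F : States N T → (Fin T → Assignment M N) → ℝ) : ℝ :=
  ∑ x : States N T, stateProb ν x * ∑ a : Fin T → Assignment M N, actionProb π x a * F x a

section expect

variable {M N T : ℕ} (ν : Config N T) (π : Policy M N)

theorem expect_mono {F G : States N T → (Fin T → Assignment M N) → ℝ}
    (h : ∀ x a, F x a ≤ G x a) : expect ν π F ≤ expect ν π G :=
  sum_le_sum fun x _ => mul_le_mul_of_nonneg_left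
    (sum_le_sum fun a _ => mul_le_mul_of_nonneg_left (h x a) (actionProb_nonneg π x a))
    (stateProb_nonneg ν x)

theorem expect_add (F G : States N T → (Fin T → Assignment M N) → ℝ) :
    expect ν π (fun x a => F x a + G x a) = expect ν π F + expect ν π G := by
  simp only [expect, mul_add, sum_add_distrib]

theorem expect_const_mul (c : ℝ) (F : States N T → (Fin T → Assignment M N) → ℝ) :
    expect ν π (fun x a => c * F x a) = c * expect ν π F := by
  simp only [expect, mul_sum]
  exact sum_congr rfl fun x _ => sum_congr rfl fun a _ => by ring

theorem expect_sum {ι : Type*} (s : Finset ι)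
    (F : ι → States N T → (Fin T → Assignment M N) → ℝ) :
    expect ν π (fun x a => ∑ i ∈ s, F i x a) = ∑ i ∈ s, expect ν π (F i) := by
  simp only [expect, mul_sum]
  rw [sum_comm (s := s)]
  refine sum_congr rfl fun x _ => ?_
  rw [sum_comm]

end expect

/-- The schedule `b` is drawn from the history alone, so the fresh row `y` can be averaged with `b`
fixed. -/
theorem expect_succ {M N T : ℕ} (ν : Config N (T + 1)) (π : Policy M N)
    (F : States N (T + 1) → (Fin (T + 1) → Assignment M N) → ℝ) :
    expect ν π F = expect (fun t => ν t.castSucc) π (fun x a =>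
      ∑ b, (π T (fullHistory x a) b).toReal * ∑ y, rowProb (ν (Fin.last T)) y *
        F (Fin.snoc (α := fun _ => Fin N → Bool) x y)
          (Fin.snoc (α := fun _ => Assignment M N) a b)) := by
  simp only [expect]
  rw [sum_snoc]
  refine sum_congr rfl fun x _ => ?_
  simp only [stateProb_snoc, sum_snoc (β := Assignment M N), actionProb_snoc, mul_sum]
  rw [sum_comm]
  refine sum_congr rfl fun a _ => ?_
  rw [sum_comm]
  exact sum_congr rfl fun b _ => sum_congr rfl fun y _ => by ring

theorem sum_actionProb {M N : ℕ} (π : Policy M N) :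
    ∀ {T : ℕ} (x : States N T), ∑ a : Fin T → Assignment M N, actionProb π x a = 1
  | 0, x => by simp [actionProb]
  | T + 1, x => by
    rw [sum_snoc, ← sum_actionProb π (fun t : Fin T => x t.castSucc)]
    refine sum_congr rfl fun a _ => ?_
    rw [← mul_one (actionProb π (fun t : Fin T => x t.castSucc) a),
      ← sum_toReal_eq_one (π T (fullHistory (fun t : Fin T => x t.castSucc) a)), mul_sum]
    refine sum_congr rfl fun b _ => ?_
    rw [← actionProb_snoc π _ a (x (Fin.last T)) b]
    congr 1
    exact (Fin.snoc_init_self x).symm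

theorem sum_stateProb {N : ℕ} : ∀ {T : ℕ} (ν : Config N T), ∑ x, stateProb ν x = 1
  | 0, ν => by simp [stateProb]
  | T + 1, ν => by
    simp only [sum_snoc, stateProb_snoc, ← mul_sum, sum_rowProb, mul_one]
    exact sum_stateProb _

theorem expect_const {M N T : ℕ} (ν : Config N T) (π : Policy M N) (c : ℝ) :
    expect ν π (fun _ _ => c) = c := by
  simp only [expect, ← sum_mul, sum_actionProb, one_mul, sum_stateProb]

/-- The number of rounds in which client `i` uses a channel that is not good. -/
noncomputable def badUses {M N T : ℕ} (good : Fin T → Set (Fin N)) (i : Fin M)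
    (a : Fin T → Assignment M N) : ℝ := by
  classical exact ∑ t, if a t i ∈ good t then 0 else 1

/-- From age `A`, a channel of mean `μ` leads to expected age `1 + (1 - μ) A`, so mean `q` instead
of `p` adds `(p - q) A ≥ p - q`. Only this immediate loss is kept; its effect on later ages is
dropped. The bound on the final age feeds the induction for the cumulative one. -/
theorem expect_clientAoI_ge {M N : ℕ} (π : Policy M N) (i : Fin M) {p q : ℝ} (hqp : q ≤ p)
    (hp : p ≤ 1) : ∀ {T : ℕ} (ν : Config N T) (good : Fin T → Set (Fin N)),
    (∀ t, ∀ k ∈ good t, (ν t k : ℝ) = p) → (∀ t, ∀ k ∉ good t, (ν t k : ℝ) = q) →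
    meanAge p T ≤ expect ν π (finalAge i) ∧
    ∑ t ∈ range T, meanAge p (t + 1) + (p - q) * expect ν π (fun _ a => badUses good i a) ≤
      expect ν π (clientAoI i)
  | 0, ν, good, _, _ => by
    simp [expect, stateProb, actionProb, meanAge, finalAge, aoi, clientAoI, badUses]
  | T + 1, ν, good, h1, h2 => by
    classical
    obtain ⟨ih1, ih2⟩ := expect_clientAoI_ge π i hqp hp (fun t => ν t.castSucc)
      (fun t => good t.castSucc) (fun t => h1 _) (fun t => h2 _)
    set ν' : Config N T := fun t => ν t.castSucc with hν'
    -- Conditional probability of a bad use by client `i` in the last round.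
    let W : States N T → (Fin T → Assignment M N) → ℝ := fun x a =>
      ∑ b, (π T (fullHistory x a) b).toReal * if b i ∈ good (Fin.last T) then 0 else 1
    have hW : ∀ x a, 0 ≤ W x a := fun x a => sum_nonneg fun b _ =>
      mul_nonneg ENNReal.toReal_nonneg (by split_ifs <;> norm_num)
    have hrow : ∀ (b : Assignment M N) (A : ℝ),
        ∑ y, rowProb (ν (Fin.last T)) y * (if y (b i) then 1 else A + 1) =
          1 + (1 - (ν (Fin.last T) (b i) : ℝ)) * A := fun b A => by
      rw [sum_rowProb_mul _ (b i) (fun v => if v then 1 else A + 1)]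
      simp
      ring
    have hage : ∀ x a, 1 + (1 - p) * finalAge i x a + (p - q) * W x a ≤
        ∑ b, (π T (fullHistory x a) b).toReal * ∑ y, rowProb (ν (Fin.last T)) y *
          (if y (b i) then 1 else finalAge i x a + 1) := fun x a => by
      have : 1 + (1 - p) * finalAge i x a + (p - q) * W x a =
          ∑ b, (π T (fullHistory x a) b).toReal * (1 + (1 - p) * finalAge i x a +
            (p - q) * if b i ∈ good (Fin.last T) then 0 else 1) := by
        simp only [mul_add, sum_add_distrib, ← sum_mul, sum_toReal_eq_one, W, mul_sum]
        congr 1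
        · ring
        · exact sum_congr rfl fun b _ => by ring
      rw [this]
      refine sum_le_sum fun b _ => mul_le_mul_of_nonneg_left ?_ ENNReal.toReal_nonneg
      rw [hrow]
      -- Turns the loss `(p - q) * finalAge` on a bad channel into at least `p - q`.
      have := one_le_finalAge i x a
      split_ifs with hb
      · rw [h1 _ _ hb]; linarith
      · rw [h2 _ _ hb]; nlinarith
    have E1 : expect ν π (finalAge i) = expect ν' π (fun x a =>
        ∑ b, (π T (fullHistory x a) b).toReal * ∑ y, rowProb (ν (Fin.last T)) y *
          (if y (b i) then 1 else finalAge i x a + 1)) := by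
      simp only [expect_succ ν, finalAge_snoc, hν']
    have E2 : expect ν π (clientAoI i) = expect ν' π (clientAoI i) + expect ν π (finalAge i) := by
      rw [E1, expect_succ, ← expect_add]
      simp only [clientAoI_snoc, mul_add, sum_add_distrib, ← sum_mul, sum_rowProb, one_mul,
        sum_toReal_eq_one, hν']
    have E3 : expect ν π (fun _ a => badUses good i a) =
        expect ν' π (fun _ a => badUses (fun t => good t.castSucc) i a) + expect ν' π W := by
      rw [expect_succ, ← expect_add]
      simp only [badUses, Fin.sum_univ_castSucc, Fin.snoc_castSucc, Fin.snoc_last, mul_add,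
        sum_add_distrib, ← sum_mul, sum_rowProb, one_mul, sum_toReal_eq_one, W, hν']
    have E4 : 1 + (1 - p) * expect ν' π (finalAge i) + (p - q) * expect ν' π W ≤
        expect ν π (finalAge i) := by
      rw [E1]
      refine le_trans (le_of_eq ?_) (expect_mono ν' π hage)
      rw [expect_add, expect_add, expect_const, expect_const_mul, expect_const_mul]
    have E5 : 0 ≤ expect ν' π W := by
      have := expect_mono ν' π hW
      rwa [expect_const] at this
    have E6 : meanAge p (T + 1) ≤ 1 + (1 - p) * expect ν' π (finalAge i) := by
      rw [meanAge]
      have := mul_le_mul_of_nonneg_left ih1 (sub_nonneg.2 hp)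
      linarith
    refine ⟨?_, ?_⟩
    · have := mul_nonneg (sub_nonneg.2 hqp) E5
      linarith
    · rw [E2, E3, sum_range_succ, mul_add]
      linarith

/-- The same recursion, now with equality: the channel is fixed by past states, hence independent of
its current state, and always has mean `p`. -/
theorem sum_stateProb_mul_of_usesPast {M N : ℕ} (i : Fin M) {p : ℝ} :
    ∀ {T : ℕ} (ν : Config N T) (s : Fin T → States N T → Assignment M N),
    (∀ t, ∀ x y : States N T, (∀ r, r < t → x r = y r) → s t x = s t y) →
    (∀ t x, (ν t (s t x i) : ℝ) = p) →
    ∑ x, stateProb ν x * finalAge i x (fun t => s t x) = meanAge p T ∧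
    ∑ x, stateProb ν x * clientAoI i x (fun t => s t x) = ∑ t ∈ range T, meanAge p (t + 1)
  | 0, ν, s, _, _ => by
    simp [stateProb, meanAge, finalAge, aoi, clientAoI]
  | T + 1, ν, s, hs, hp => by
    let ext : States N T → (Fin N → Bool) → States N (T + 1) := fun x y =>
      Fin.snoc (α := fun _ => Fin N → Bool) x y
    -- Arbitrary filler: no schedule depends on the last row, as `hind` shows.
    let y₀ : Fin N → Bool := fun _ => false
    let s' : Fin T → States N T → Assignment M N := fun t x => s t.castSucc (ext x y₀)
    have hext : ∀ x y (t : Fin T), ext x y t.castSucc = x t := fun x y t =>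
      Fin.snoc_castSucc (α := fun _ => Fin N → Bool) y x t
    have hind : ∀ (x y) (t : Fin (T + 1)), s t (ext x y) = s t (ext x y₀) := fun x y t => by
      refine hs t _ _ fun r hr => ?_
      obtain ⟨r, rfl⟩ := Fin.exists_castSucc_eq.2 (ne_of_lt (lt_of_lt_of_le hr (Fin.le_last t)))
      rw [hext, hext]
    have hplay : ∀ x y, (fun t => s t (ext x y)) = Fin.snoc (α := fun _ => Assignment M N)
        (fun t => s' t x) (s (Fin.last T) (ext x y₀)) := fun x y => by
      funext t
      rw [hind]
      refine Fin.lastCases ?_ (fun t => ?_) t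
      · rw [Fin.snoc_last]
      · rw [Fin.snoc_castSucc]
    obtain ⟨ih1, ih2⟩ := sum_stateProb_mul_of_usesPast i (p := p) (fun t => ν t.castSucc) s'
      (fun t x y h => hs _ _ _ fun r hr => by
        obtain ⟨r, rfl⟩ := Fin.exists_castSucc_eq.2
          (ne_of_lt (lt_of_lt_of_le hr (Fin.le_last _)))
        rw [hext, hext]
        exact h r (Fin.castSucc_lt_castSucc_iff.1 hr))
      (fun t x => hp _ _)
    have hrow : ∀ x, ∑ y, rowProb (ν (Fin.last T)) y *
        (if y (s (Fin.last T) (ext x y₀) i) then 1 else finalAge i x (fun t => s' t x) + 1) =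
          1 + (1 - p) * finalAge i x (fun t => s' t x) := fun x => by
      rw [sum_rowProb_mul _ (s (Fin.last T) (ext x y₀) i)
        (fun v => if v then 1 else finalAge i x (fun t => s' t x) + 1), hp]
      simp
      ring
    have H1 : ∑ x, stateProb ν x * finalAge i x (fun t => s t x) = meanAge p (T + 1) := by
      rw [sum_snoc, meanAge, ← ih1, mul_sum, ← sum_stateProb (fun t : Fin T => ν t.castSucc),
        ← sum_add_distrib]
      refine sum_congr rfl fun x _ => ?_
      refine (sum_congr rfl fun y _ => ?_).trans ((mul_sum _ _ _).symm.trans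
        ((congrArg (stateProb (fun t : Fin T => ν t.castSucc) x * ·) (hrow x)).trans ?_))
      · rw [stateProb_snoc, mul_assoc]
        congr 2
        exact (congrArg (finalAge i (ext x y)) (hplay x y)).trans (finalAge_snoc _ _ _ _ _)
      · rw [sum_stateProb]
        ring
    refine ⟨H1, ?_⟩
    rw [sum_range_succ, ← H1, ← ih2, sum_snoc, sum_snoc, ← sum_add_distrib]
    refine sum_congr rfl fun x _ => ?_
    have h1 : stateProb (fun t : Fin T => ν t.castSucc) x * clientAoI i x (fun t => s' t x) =
        ∑ y, stateProb ν (ext x y) * clientAoI i x (fun t => s' t x) := by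
      simp only [ext, stateProb_snoc, ← sum_mul, ← mul_sum, sum_rowProb, mul_one]
    rw [h1, ← sum_add_distrib]
    refine sum_congr rfl fun y _ => ?_
    change stateProb ν (ext x y) * clientAoI i (ext x y) (fun t => s t (ext x y)) =
      _ + stateProb ν (ext x y) * finalAge i (ext x y) (fun t => s t (ext x y))
    rw [hplay, finalAge_snoc, clientAoI_snoc, mul_add]

/-- A strategy using only past states and only channels of mean `p`. -/
theorem informedAoI_eq_of_mean_eq {M N T : ℕ} {p : ℝ} (ν : Config N T) (o : Informed M N T)
    (ho : o.UsesPast) (hp : ∀ t x i, (ν t (o ν t x i) : ℝ) = p) :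
    informedAoI ν o = M * ∑ t ∈ range T, meanAge p (t + 1) := by
  simp only [informedAoI, totalAoI_eq, mul_sum]
  rw [sum_comm]
  simp only [← mul_sum]
  rw [sum_congr rfl fun i _ =>
    (sum_stateProb_mul_of_usesPast i ν (o ν) (ho ν) fun t x => hp t x i).2]
  simp

theorem policyAoI_ge {M N T : ℕ} (π : Policy M N) {p q : ℝ} (hqp : q ≤ p) (hp : p ≤ 1)
    (ν : Config N T) (good : Fin T → Set (Fin N))
    (h1 : ∀ t, ∀ k ∈ good t, (ν t k : ℝ) = p) (h2 : ∀ t, ∀ k ∉ good t, (ν t k : ℝ) = q) :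
    M * ∑ t ∈ range T, meanAge p (t + 1) +
      (p - q) * expect ν π (fun _ a => ∑ i, badUses good i a) ≤ policyAoI ν π := by
  have h := sum_le_sum fun (i : Fin M) (_ : i ∈ univ) =>
    (expect_clientAoI_ge π i hqp hp ν good h1 h2).2
  rw [sum_add_distrib, ← mul_sum, ← expect_sum, ← expect_sum] at h
  simpa [policyAoI, expect, totalAoI_eq] using h

/-! ### Overlap of two state laws -/

/-- The affinity of two laws bounds their overlap from below. -/
theorem sq_sum_sqrt_mul_le {α : Type*} [Fintype α] {f g : α → ℝ} (hf : ∀ x, 0 ≤ f x)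
    (hg : ∀ x, 0 ≤ g x) (hf1 : ∑ x, f x = 1) (hg1 : ∑ x, g x = 1) :
    (∑ x, √(f x * g x)) ^ 2 ≤ 2 * ∑ x, min (f x) (g x) := by
  have hmin : ∀ x, 0 ≤ min (f x) (g x) := fun x => le_min (hf x) (hg x)
  have hmax : ∀ x, 0 ≤ max (f x) (g x) := fun x => (hf x).trans (le_max_left _ _)
  -- Cauchy–Schwarz applied to `√(f g) = √(min f g) √(max f g)`.
  have h := sum_mul_sq_le_sq_mul_sq univ (fun x => √(min (f x) (g x))) fun x => √(max (f x) (g x))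
  simp only [← Real.sqrt_mul (hmin _), min_mul_max, Real.sq_sqrt (hmin _),
    Real.sq_sqrt (hmax _)] at h
  have hle : ∑ x, max (f x) (g x) ≤ 2 := by
    calc ∑ x, max (f x) (g x) ≤ ∑ x, (f x + g x) := sum_le_sum fun x _ =>
          max_le_add_of_nonneg (hf x) (hg x)
      _ = 2 := by rw [sum_add_distrib, hf1, hg1]; norm_num
  have h0 : 0 ≤ ∑ x, min (f x) (g x) := sum_nonneg fun x _ => hmin x
  nlinarith

theorem sum_sqrt_rowProb {N : ℕ} (m m' : Fin N → unitInterval) :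
    ∑ y, √(rowProb m y * rowProb m' y) =
      ∏ k, (√((m k : ℝ) * m' k) + √((1 - (m k : ℝ)) * (1 - m' k))) := by
  have h := sum_prod_bool (fun k b => √((if b then (m k : ℝ) else 1 - (m k : ℝ)) *
    (if b then (m' k : ℝ) else 1 - (m' k : ℝ))))
  simp only [if_true, Bool.false_eq_true, if_false] at h
  rw [← h]
  refine sum_congr rfl fun y _ => ?_
  rw [rowProb, rowProb, ← prod_mul_distrib, Real.sqrt_prod]
  intro k _
  have := (m k).2.1
  have := (m k).2.2
  have := (m' k).2.1
  have := (m' k).2.2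
  split_ifs <;> apply mul_nonneg <;> linarith

theorem sum_sqrt_stateProb {N T : ℕ} (ν ν' : Config N T) :
    ∑ x, √(stateProb ν x * stateProb ν' x) =
      ∏ t, ∑ y, √(rowProb (ν t) y * rowProb (ν' t) y) := by
  have h := Finset.prod_univ_sum (fun _ : Fin T => (univ : Finset (Fin N → Bool)))
    (fun t y => √(rowProb (ν t) y * rowProb (ν' t) y))
  rw [Fintype.piFinset_univ] at h
  rw [h]
  exact sum_congr rfl fun x _ => by
    rw [stateProb_eq, stateProb_eq, ← prod_mul_distrib, Real.sqrt_prod]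
    exact fun t _ => mul_nonneg (rowProb_nonneg _ _) (rowProb_nonneg _ _)

/-- Two rows of means that differ by exchanging the means `p` and `1 - p` of two channels. -/
theorem sum_sqrt_rowProb_swap {N : ℕ} {m m' : Fin N → unitInterval} {u v : Fin N} (huv : u ≠ v)
    {p : ℝ} (hp : 0 ≤ p * (1 - p)) (hmu : (m u : ℝ) = p) (hmv : (m v : ℝ) = 1 - p)
    (hmu' : (m' u : ℝ) = 1 - p) (hmv' : (m' v : ℝ) = p)
    (hne : ∀ k, k ≠ u → k ≠ v → m k = m' k) :
    ∑ y, √(rowProb m y * rowProb m' y) = 4 * (p * (1 - p)) := by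
  rw [sum_sqrt_rowProb, ← prod_subset (subset_univ {u, v}), prod_pair huv, hmu, hmv, hmu', hmv']
  · rw [sub_sub_cancel, mul_comm (1 - p) p]
    linear_combination 4 * Real.mul_self_sqrt hp
  · intro k _ hk
    simp only [mem_insert, mem_singleton, not_or] at hk
    rw [hne k hk.1 hk.2, Real.sqrt_mul_self (m' k).2.1,
      Real.sqrt_mul_self (sub_nonneg.2 (m' k).2.2)]
    ring

/-- Given the states, the law `actionProb π x` of the schedules is the same under both
configurations, so on the common mass `min` the two losses can be added pointwise. -/
theorem expect_add_expect_ge {M N T : ℕ} (ν ν' : Config N T) (π : Policy M N)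
    {F G : States N T → (Fin T → Assignment M N) → ℝ} {K : ℝ} (hF : ∀ x a, 0 ≤ F x a)
    (hG : ∀ x a, 0 ≤ G x a) (hK : ∀ x a, K ≤ F x a + G x a) :
    K * ∑ x, min (stateProb ν x) (stateProb ν' x) ≤ expect ν π F + expect ν' π G := by
  rw [expect, expect, ← sum_add_distrib, mul_sum]
  refine sum_le_sum fun x _ => ?_
  have hF' : 0 ≤ ∑ a, actionProb π x a * F x a :=
    sum_nonneg fun a _ => mul_nonneg (actionProb_nonneg π x a) (hF x a)
  have hG' : 0 ≤ ∑ a, actionProb π x a * G x a :=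
    sum_nonneg fun a _ => mul_nonneg (actionProb_nonneg π x a) (hG x a)
  have hs : K ≤ ∑ a, actionProb π x a * F x a + ∑ a, actionProb π x a * G x a := by
    rw [← sum_add_distrib, ← mul_one K, ← sum_actionProb π x, mul_sum]
    refine sum_le_sum fun a _ => ?_
    have := mul_le_mul_of_nonneg_left (hK x a) (actionProb_nonneg π x a)
    linarith
  have h0 : 0 ≤ min (stateProb ν x) (stateProb ν' x) :=
    le_min (stateProb_nonneg _ _) (stateProb_nonneg _ _)
  have h1 := mul_le_mul_of_nonneg_right (min_le_left (stateProb ν x) (stateProb ν' x)) hF'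
  have h2 := mul_le_mul_of_nonneg_right (min_le_right (stateProb ν x) (stateProb ν' x)) hG'
  have h3 := mul_le_mul_of_nonneg_left hs h0
  linarith

/-! ### The hard pair of configurations -/

/-- The first `M` channels (`j = false`), or these with the last one replaced by the next. -/
def goodSet (M N : ℕ) (j : Bool) : Set (Fin N) :=
  {k | if j then (k : ℕ) ≤ M ∧ (k : ℕ) + 1 ≠ M else (k : ℕ) < M}

/-- An enumeration of `goodSet`. -/
def goodAssignment {M N : ℕ} (h : M < N) (j : Bool) : Assignment M N where
  toFun i := ⟨if j ∧ (i : ℕ) + 1 = M then M else i, by split_ifs <;> omega⟩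
  inj' i i' hii := by
    have := congrArg Fin.val hii
    ext
    simp only at this
    split_ifs at this <;> omega

theorem goodAssignment_mem {M N : ℕ} (h : M < N) (j : Bool) (i : Fin M) :
    goodAssignment h j i ∈ goodSet M N j := by
  cases j
  · simp [goodAssignment, goodSet]
  · simp only [goodAssignment, goodSet, Set.mem_ofPred_eq, Function.Embedding.coeFn_mk, if_true,
      true_and]
    split_ifs <;> omega

/-- The two good sets meet in the channels with index below `M - 1`, too few for `M` distinct ones.
-/
theorem not_subset_goodSets {M N : ℕ} (hM : 1 ≤ M) {A : Finset (Fin N)} (hA : A.card = M)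
    (j : Bool) (h1 : ∀ k ∈ A, k ∈ goodSet M N j) (h2 : ∀ k ∈ A, k ∈ goodSet M N (!j)) : False := by
  have h : A.card ≤ (range (M - 1)).card := by
    refine card_le_card_of_injOn Fin.val (fun k hk => ?_) Fin.val_injective.injOn
    have a1 := h1 k hk
    have a2 := h2 k hk
    cases j <;> simp [goodSet] at a1 a2 <;> simp <;> omega
  rw [card_range] at h
  omega

open Classical in
/-- Means `p` on the good set and `q` elsewhere; the good set of the first round differs. -/
noncomputable def hardConfig (M N T : ℕ) (p q : unitInterval) (j : Bool) : Config N T :=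
  fun t k => if k ∈ goodSet M N (if (t : ℕ) = 0 then !j else j) then p else q

section hardConfig

variable {M N T : ℕ} {p q : unitInterval} {j : Bool}

theorem hardConfig_of_mem {t : Fin T} {k : Fin N}
    (h : k ∈ goodSet M N (if (t : ℕ) = 0 then !j else j)) : hardConfig M N T p q j t k = p :=
  if_pos h

theorem hardConfig_of_notMem {t : Fin T} {k : Fin N}
    (h : k ∉ goodSet M N (if (t : ℕ) = 0 then !j else j)) : hardConfig M N T p q j t k = q :=
  if_neg h

theorem hardConfig_congr {t t' : Fin T} {k : Fin N} {j' : Bool}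
    (h : k ∈ goodSet M N (if (t : ℕ) = 0 then !j else j) ↔
      k ∈ goodSet M N (if (t' : ℕ) = 0 then !j' else j')) :
    hardConfig M N T p q j t k = hardConfig M N T p q j' t' k := by
  by_cases hk : k ∈ goodSet M N (if (t : ℕ) = 0 then !j else j)
  · rw [hardConfig_of_mem hk, hardConfig_of_mem (h.1 hk)]
  · rw [hardConfig_of_notMem hk, hardConfig_of_notMem (mt h.2 hk)]

/-- A super-arm with a channel outside the good set has sum strictly below `M p`, which
`goodAssignment` attains. -/
theorem mem_goodSet_of_isBestSuperArm (hN : M < N) (hqp : q < p) {t : Fin T}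
    {A : Finset (Fin N)} (hA : IsBestSuperArm M (hardConfig M N T p q j) t A) :
    ∀ k ∈ A, k ∈ goodSet M N (if (t : ℕ) = 0 then !j else j) := by
  intro k hk
  by_contra hk'
  have h := hA.2 (univ.map (goodAssignment hN (if (t : ℕ) = 0 then !j else j))) (by simp)
  rw [sum_map, sum_congr rfl fun i _ => by
    rw [hardConfig_of_mem (goodAssignment_mem hN _ i)]] at h
  have hlt : ∑ k ∈ A, (hardConfig M N T p q j t k : ℝ) < ∑ k ∈ A, (p : ℝ) := by
    refine sum_lt_sum (fun l _ => ?_) ⟨k, hk, ?_⟩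
    · by_cases hl : l ∈ goodSet M N (if (t : ℕ) = 0 then !j else j)
      · rw [hardConfig_of_mem hl]
      · rw [hardConfig_of_notMem hl]
        exact hqp.le
    · rw [hardConfig_of_notMem hk']
      exact hqp
  simp only [sum_const, card_univ, Fintype.card_fin, hA.1] at h hlt
  exact absurd h (not_le.2 hlt)

theorem ncard_breakpoints_hardConfig :
    (breakpoints (hardConfig M N T p q j)).ncard ≤ 1 := by
  refine (Set.ncard_le_one_iff (Set.toFinite _)).2 ?_
  have key : ∀ {t : Fin T}, t ∈ breakpoints (hardConfig M N T p q j) → (t : ℕ) = 1 := by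
    rintro t ⟨s, hst, hne⟩
    by_contra ht
    refine hne (funext fun k => hardConfig_congr ?_)
    rw [if_neg (show (s : ℕ) ≠ 0 by omega), if_neg (show (t : ℕ) ≠ 0 by omega)]
  exact fun _ _ ha hb => Fin.ext ((key ha).trans (key hb).symm)

theorem bestSuperArmChanges_hardConfig (hM : 1 ≤ M) (hN : M < N) (hqp : q < p) (hT : 2 ≤ T) :
    BestSuperArmChanges M (hardConfig M N T p q j) := by
  refine ⟨⟨0, by omega⟩, ⟨1, by omega⟩, rfl, fun A ⟨h0, h1⟩ => ?_⟩
  have a0 := mem_goodSet_of_isBestSuperArm hN hqp h0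
  have a1 := mem_goodSet_of_isBestSuperArm hN hqp h1
  exact not_subset_goodSets hM h0.1 j a1 a0

/-- A mean oracle uses only channels of mean `p` and attains equality; a CSI oracle is compared with
the strategy `o'` that ignores all states. -/
theorem informedAoI_hardConfig_le (hN : M < N) (hqp : q < p) (o : Informed M N T)
    (ho : o.IsMeanOracle ∨ o.IsCSIOracle) :
    informedAoI (hardConfig M N T p q j) o ≤ M * ∑ t ∈ range T, meanAge p (t + 1) := by
  rcases ho with ⟨ho, hb⟩ | ⟨-, ho⟩
  · refine (informedAoI_eq_of_mean_eq _ o ho fun t x i => ?_).le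
    rw [hardConfig_of_mem (mem_goodSet_of_isBestSuperArm hN hqp (hb _ t x) _
      (mem_map_of_mem _ (mem_univ i)))]
  · let o' : Informed M N T := fun _ t _ => goodAssignment hN (if (t : ℕ) = 0 then !j else j)
    refine (ho o' (fun _ _ _ _ _ => rfl) _).trans
      (informedAoI_eq_of_mean_eq _ o' (fun _ _ _ _ _ => rfl) fun t x i => ?_).le
    rw [hardConfig_of_mem (goodAssignment_mem hN _ i)]

theorem sum_badUses_nonneg (good : Fin T → Set (Fin N)) (a : Fin T → Assignment M N) :
    0 ≤ ∑ i, badUses good i a :=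
  sum_nonneg fun i _ => sum_nonneg fun t _ => by split_ifs <;> norm_num

theorem sum_badUses_add_ge (hM : 1 ≤ M) (a : Fin T → Assignment M N) :
    (T : ℝ) ≤ ∑ i, badUses (fun t => goodSet M N (if (t : ℕ) = 0 then !false else false)) i a +
      ∑ i, badUses (fun t => goodSet M N (if (t : ℕ) = 0 then !true else true)) i a := by
  classical
  simp only [badUses]
  rw [sum_comm, sum_comm (s := (univ : Finset (Fin M))), ← sum_add_distrib]
  have hT : (T : ℝ) = ∑ t : Fin T, (1 : ℝ) := by simp
  rw [hT]
  refine sum_le_sum fun t _ => ?_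
  rw [← sum_add_distrib]
  have hnn : ∀ i ∈ (univ : Finset (Fin M)), (0 : ℝ) ≤
      (if a t i ∈ goodSet M N (if (t : ℕ) = 0 then !false else false) then 0 else 1) +
      (if a t i ∈ goodSet M N (if (t : ℕ) = 0 then !true else true) then 0 else 1) :=
    fun i _ => by split_ifs <;> norm_num
  obtain ⟨i, hi⟩ : ∃ i, ¬ (a t i ∈ goodSet M N (if (t : ℕ) = 0 then !false else false) ∧
      a t i ∈ goodSet M N (if (t : ℕ) = 0 then !true else true)) := by
    by_contra! hall
    refine not_subset_goodSets hM (A := univ.map (a t)) (by simp)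
      (if (t : ℕ) = 0 then !false else false) (fun k hk => ?_) (fun k hk => ?_) <;>
    · obtain ⟨i, -, rfl⟩ := mem_map.1 hk
      have := hall i
      split_ifs at this ⊢ <;> simp_all
  refine le_trans ?_ (single_le_sum hnn (mem_univ i))
  by_cases h1 : a t i ∈ goodSet M N (if (t : ℕ) = 0 then !false else false)
  · rw [if_pos h1, if_neg fun h2 => hi ⟨h1, h2⟩]; norm_num
  · rw [if_neg h1]
    split_ifs <;> norm_num

/-- In each round the configurations differ by exchanging `p` and `q = 1 - p` between channels `M -
1` and `M`, so each round contributes one factor `4p(1 - p)`. -/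
theorem sum_sqrt_stateProb_hardConfig (hM : 1 ≤ M) (hN : M < N) (hq : (q : ℝ) = 1 - p) :
    ∑ x, √(stateProb (hardConfig M N T p q false) x * stateProb (hardConfig M N T p q true) x) =
      (4 * ((p : ℝ) * (1 - p))) ^ T := by
  have hp : 0 ≤ (p : ℝ) * (1 - p) := mul_nonneg p.2.1 (sub_nonneg.2 p.2.2)
  let u : Fin N := ⟨M - 1, by omega⟩
  let v : Fin N := ⟨M, hN⟩
  have huv : u ≠ v := fun h => by
    have := congrArg Fin.val h
    simp only [u, v] at this
    omega
  have hne : ∀ k : Fin N, k ≠ u → k ≠ v →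
      (k ∈ goodSet M N true ↔ k ∈ goodSet M N false) := fun k hu hv => by
    have hu' : (k : ℕ) ≠ M - 1 := fun h => hu (Fin.ext h)
    have hv' : (k : ℕ) ≠ M := fun h => hv (Fin.ext h)
    simp [goodSet]
    omega
  have uf : u ∈ goodSet M N false := by simp [goodSet, u]; omega
  have ut : u ∉ goodSet M N true := by simp [goodSet, u]; omega
  have vf : v ∉ goodSet M N false := by simp [goodSet, v]
  have vt : v ∈ goodSet M N true := by simp [goodSet, v]
  rw [sum_sqrt_stateProb]
  rw [prod_congr rfl (g := fun _ => 4 * ((p : ℝ) * (1 - p))), prod_const, card_univ,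
    Fintype.card_fin]
  intro t _
  by_cases ht : (t : ℕ) = 0
  -- The first round uses the opposite good sets, so `u` and `v` trade roles.
  · refine sum_sqrt_rowProb_swap huv.symm hp ?_ ?_ ?_ ?_ fun k hv hu => hardConfig_congr ?_
    iterate 4 simp [hardConfig, ht, uf, ut, vf, vt, hq]
    simpa [ht] using hne k hu hv
  · refine sum_sqrt_rowProb_swap huv hp ?_ ?_ ?_ ?_ fun k hu hv => hardConfig_congr ?_
    iterate 4 simp [hardConfig, ht, uf, ut, vf, vt, hq]
    simpa [ht] using (hne k hu hv).symm

theorem hardConfig_ne (hN : M < N) (hT : 1 ≤ T) (hqp : q < p) :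
    hardConfig M N T p q false ≠ hardConfig M N T p q true := by
  intro h
  have := congrFun (congrFun h ⟨0, hT⟩) ⟨M, hN⟩
  simp [hardConfig, goodSet] at this
  have h2 : M + 1 ≠ M := by omega
  exact absurd this.symm hqp.ne

end hardConfig

/-! ### The uniform prior and the final estimate -/

theorem regret_uniform_pair {M N T : ℕ} {ν ν' : Config N T} (hne : ν ≠ ν')
    (hs : ({ν, ν'} : Finset (Config N T)).Nonempty) (π : Policy M N) (o : Informed M N T) :
    regret (PMF.uniformOfFinset {ν, ν'} hs) π o =
      1 / 2 * (policyAoI ν π - informedAoI ν o + (policyAoI ν' π - informedAoI ν' o)) := by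
  rw [regret, tsum_eq_sum (s := {ν, ν'}), sum_pair hne]
  · rw [PMF.uniformOfFinset_apply_of_mem _ (by simp), PMF.uniformOfFinset_apply_of_mem _ (by simp),
      card_pair hne]
    simp
    ring
  · intro b hb
    rw [PMF.uniformOfFinset_apply_of_notMem _ hb]
    simp

/-- Here `4p(1 - p) = 1 - 1/(4T)`; Bernoulli's inequality with exponent `2T` bounds the squared
affinity below by `1/2`, and the overlap is at least half of that. -/
theorem sum_min_stateProb_hardConfig_ge {M N T : ℕ} {p q : unitInterval} (hM : 1 ≤ M)
    (hN : M < N) (hT : 1 ≤ T) (hp : (p : ℝ) = 1 / 2 + 1 / (4 * √T)) (hq : (q : ℝ) = 1 - p) :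
    1 / 4 ≤ ∑ x, min (stateProb (hardConfig M N T p q false) x)
      (stateProb (hardConfig M N T p q true) x) := by
  have h := sq_sum_sqrt_mul_le (stateProb_nonneg (hardConfig M N T p q false))
    (stateProb_nonneg (hardConfig M N T p q true)) (sum_stateProb _) (sum_stateProb _)
  rw [sum_sqrt_stateProb_hardConfig hM hN hq, ← pow_mul] at h
  have hT0 : (0 : ℝ) < T := by exact_mod_cast hT
  have hT1 : (1 : ℝ) ≤ T := by exact_mod_cast hT
  have hsq : √(T : ℝ) ^ 2 = T := Real.sq_sqrt hT0.le
  have hs0 : 0 < √(T : ℝ) := Real.sqrt_pos.2 hT0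
  have hpp : 4 * ((p : ℝ) * (1 - p)) = 1 + -(1 / (4 * T)) := by
    rw [hp]
    field_simp
    linear_combination (4 : ℝ) * hsq
  have hle : 1 / (4 * (T : ℝ)) ≤ 1 := by
    rw [div_le_one (by linarith)]
    linarith
  have hb := one_add_mul_le_pow (a := -(1 / (4 * (T : ℝ)))) (by linarith) (T * 2)
  rw [← hpp] at hb
  have hc : 1 + ((T * 2 : ℕ) : ℝ) * -(1 / (4 * (T : ℝ))) = 1 / 2 := by
    push_cast
    field_simp
    norm_num
  rw [hc] at hb
  linarith

end ChannelAoI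

theorem theorem4 :
    ∃ c : ℝ, 0 < c ∧ ∀ M N T : ℕ, 1 ≤ M → M < N → 1 ≤ T →
      ∃ D : PMF (ChannelAoI.Config N T),
        (∀ ν ∈ D.support, (ChannelAoI.breakpoints ν).ncard ≤ 1 ∧
          (2 ≤ T → ChannelAoI.BestSuperArmChanges M ν)) ∧
        ∀ (π : ChannelAoI.Policy M N) (o : ChannelAoI.Informed M N T),
          o.IsMeanOracle ∨ o.IsCSIOracle →
            c * √((M : ℝ) * (T : ℝ) / (N : ℝ)) ≤ ChannelAoI.regret D π o := by
  open ChannelAoI in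
  -- Prior weight `1/2` times gap `1/(2√T)` times `T` bad uses times overlap `1/4` is `√T / 16`.
  refine ⟨1 / 16, by norm_num, fun M N T hM hN hT => ?_⟩
  have hT1 : (1 : ℝ) ≤ T := by exact_mod_cast hT
  have hsq : √(T : ℝ) ^ 2 = T := Real.sq_sqrt (by linarith)
  have hs1 : 1 ≤ √(T : ℝ) := Real.one_le_sqrt.2 hT1
  have hε0 : 0 < 1 / (4 * √(T : ℝ)) := by positivity
  have hε1 : 1 / (4 * √(T : ℝ)) ≤ 1 / 4 := by
    rw [div_le_div_iff₀ (by positivity) (by norm_num)]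
    linarith
  -- A deviation of order `1/√T` is small enough for the laws of `T` rounds to keep a constant
  -- overlap.
  let p : unitInterval := ⟨1 / 2 + 1 / (4 * √(T : ℝ)), by constructor <;> linarith⟩
  let q : unitInterval := ⟨1 - (1 / 2 + 1 / (4 * √(T : ℝ))), by constructor <;> linarith⟩
  have hp : (p : ℝ) = 1 / 2 + 1 / (4 * √(T : ℝ)) := rfl
  have hq : (q : ℝ) = 1 - p := rfl
  have hqp' : (q : ℝ) < p := by linarith
  have hqp : q < p := hqp'
  refine ⟨PMF.uniformOfFinset {hardConfig M N T p q false, hardConfig M N T p q true} (by simp),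
    fun ν hν => ?_, fun π o ho => ?_⟩
  · obtain ⟨j, rfl⟩ : ∃ j, ν = hardConfig M N T p q j := by
      rw [PMF.mem_support_uniformOfFinset_iff, mem_insert, mem_singleton] at hν
      exact hν.elim (fun h => ⟨_, h⟩) fun h => ⟨_, h⟩
    exact ⟨ncard_breakpoints_hardConfig, bestSuperArmChanges_hardConfig hM hN hqp⟩
  · rw [regret_uniform_pair (hardConfig_ne hN hT hqp)]
    have hlow := fun j => policyAoI_ge π hqp'.le p.2.2 (hardConfig M N T p q j)
      (fun t => goodSet M N (if (t : ℕ) = 0 then !j else j))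
      (fun t k hk => by rw [hardConfig_of_mem hk]) (fun t k hk => by rw [hardConfig_of_notMem hk])
    have h0 := hlow false
    have h1 := hlow true
    have i0 := informedAoI_hardConfig_le (j := false) hN hqp o ho
    have i1 := informedAoI_hardConfig_le (j := true) hN hqp o ho
    have hB := expect_add_expect_ge (hardConfig M N T p q false) (hardConfig M N T p q true) π
      (fun _ a => sum_badUses_nonneg _ a) (fun _ a => sum_badUses_nonneg _ a)
      (fun _ a => sum_badUses_add_ge hM a)
    have hmin := sum_min_stateProb_hardConfig_ge hM hN hT hp hq
    have hgap : (p : ℝ) - q = 1 / (2 * √(T : ℝ)) := by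
      rw [hq, hp]
      field_simp
      ring
    have hTB : (T : ℝ) * (1 / 4) ≤ _ := (mul_le_mul_of_nonneg_left hmin (by linarith)).trans hB
    have hG := mul_le_mul_of_nonneg_left hTB (sub_nonneg.2 hqp'.le)
    have hval : ((p : ℝ) - q) * (T * (1 / 4)) = √(T : ℝ) / 8 := by
      rw [hgap]
      field_simp
      linear_combination (-8 : ℝ) * hsq
    have hroot : √((M : ℝ) * T / N) ≤ √(T : ℝ) := by
      refine Real.sqrt_le_sqrt ?_
      have hN0 : (0 : ℝ) < N := by exact_mod_cast (by omega : 0 < N)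
      rw [div_le_iff₀ hN0, mul_comm]
      exact mul_le_mul_of_nonneg_left (by exact_mod_cast hN.le) (by linarith)
    linarith
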